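/- Let $\mathcal W$ be a real, signed, finite Borel measure on $\mathbb R$ which is even and normalized by $\widehat{\mathcal W}(0)=1$, where $\widehat{\mathcal W}(\xi)=\int_{\mathbb R}e^{-ix\xi}\,d\mathcal W(x)$. Assume that there is $\kappa\ge 0$ such that $$\widehat{\mathcal W}(\xi)\ \ge\ (1-\kappa\xi^2)^+\qquad\text{for a.e. }\xi\in\mathbb R,$$ where $s^+=\max\{s,0\}$. Let $$\mathcal E(\mathbb R)=\{v\in H^1_{\rm loc}(\mathbb R;\mathbb C):\ 1-|v|^2\in L^2(\mathbb R),\ v'\in L^2(\mathbb R)\},$$ $$\mathcal E_{\rm odd}(\mathbb R)=\{v\in\mathcal E(\mathbb R):\ v\text{ is real-valued and odd}\},$$ and, with $(\mathcal W*f)(x)=\int_{\mathbb R}f(x-y)\,d\mathcal W(y)$, let $$E(v)=\frac12\int_{\mathbb R}|v'|^2\,dx+\frac14\int_{\mathbb R}\big(\mathcal W*(1-|v|^2)\big)(1-|v|^2)\,dx .$$ Then there exists $u\in\mathcal E_{\rm odd}(\mathbb R)$ such that $$E(u)=\min\{E(v):\ v\in\mathcal E_{\rm odd}(\mathbb R)\}$$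 and $u$ is a solution of $$u''+u\,\big(\mathcal W*(1-u^2)\big)=0\quad\text{in }\mathbb R ,$$ in the weak sense: $\int_{\mathbb R}u'\varphi'\,dx=\int_{\mathbb R}\big(\mathcal W*(1-u^2)\big)u\,\varphi\,dx$ for every $\varphi\in C^1_c(\mathbb R)$. Moreover the continuous representative of $u$ vanishes at some point; that is, $u$ is a black soliton (a finite energy solution vanishing at some point). -/

import Mathlib

open MeasureTheory
open scoped ContDiff

noncomputable section

namespace NonlocalGP

/-- The signed measure `W` is even: `W(-A) = W(A)` for every Borel set `A`. -/
def IsEven (W : SignedMeasure ℝ) : Prop :=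
  ∀ A : Set ℝ, MeasurableSet A → W (Neg.neg ⁻¹' A) = W A

/-- The Fourier transform `Ŵ(ξ) = ∫ e^{-ixξ} dW(x)` of a finite signed Borel measure, the integral
being taken against the two parts of the Jordan decomposition `W = W⁺ - W⁻`. -/
def fourier (W : SignedMeasure ℝ) (ξ : ℝ) : ℂ :=
  (∫ x, Complex.exp (-(Complex.I * x * ξ)) ∂W.toJordanDecomposition.posPart) -
    ∫ x, Complex.exp (-(Complex.I * x * ξ)) ∂W.toJordanDecomposition.negPart

/-- The convolution `(W * f)(x) = ∫ f(x - y) dW(y)`. -/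
def conv (W : SignedMeasure ℝ) (f : ℝ → ℝ) (x : ℝ) : ℝ :=
  (∫ y, f (x - y) ∂W.toJordanDecomposition.posPart) -
    ∫ y, f (x - y) ∂W.toJordanDecomposition.negPart

/-- `W` is an even finite signed Borel measure with `Ŵ(0) = 1`. -/
def IsNormalizedEven (W : SignedMeasure ℝ) : Prop :=
  IsEven W ∧ fourier W 0 = 1

/-- There is `κ ≥ 0` such that `Ŵ(ξ) ≥ (1 - κ ξ²)⁺` for a.e. `ξ`. (For even `W` the number `Ŵ(ξ)`
is real, hence equal to its real part.) -/
def FourierLowerBound (W : SignedMeasure ℝ) : Prop :=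
  ∃ κ : ℝ, 0 ≤ κ ∧ ∀ᵐ ξ : ℝ, max (1 - κ * ξ ^ 2) 0 ≤ (fourier W ξ).re

/-- `g` is a weak derivative of `v` on `ℝ`. -/
def HasWeakDeriv (v g : ℝ → ℂ) : Prop :=
  LocallyIntegrable v ∧ LocallyIntegrable g ∧
    ∀ φ : ℝ → ℝ, ContDiff ℝ ∞ φ → HasCompactSupport φ →
      ∫ x, deriv φ x • v x = - ∫ x, φ x • g x

open Classical in
/-- The weak derivative `v'` (unique up to null sets); it is `0` if there is none. -/
def weakDeriv (v : ℝ → ℂ) : ℝ → ℂ :=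
  if h : ∃ g, HasWeakDeriv v g then h.choose else 0

/-- `f ∈ L²_loc(ℝ)`. -/
def MemL2loc (f : ℝ → ℂ) : Prop :=
  ∀ K : Set ℝ, IsCompact K → MemLp f 2 (volume.restrict K)

/-- `v ∈ H¹_loc(ℝ)`. -/
def MemH1loc (v : ℝ → ℂ) : Prop :=
  MemL2loc v ∧ ∃ g, HasWeakDeriv v g ∧ MemL2loc g

/-- `η = 1 - |v|²`. -/
def eta (v : ℝ → ℂ) (x : ℝ) : ℝ := 1 - ‖v x‖ ^ 2

/-- The energy space: `v ∈ H¹_loc(ℝ)` with `1 - |v|² ∈ L²(ℝ)` and `v' ∈ L²(ℝ)`. -/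
def energySpace : Set (ℝ → ℂ) :=
  {v | MemH1loc v ∧ MemLp (eta v) 2 volume ∧ MemLp (weakDeriv v) 2 volume}

/-- The real-valued odd elements of the energy space (functions being considered up to
equality almost everywhere). -/
def oddEnergySpace : Set (ℝ → ℂ) :=
  {v | v ∈ energySpace ∧ (∀ᵐ x : ℝ, (v x).im = 0) ∧ ∀ᵐ x : ℝ, v (-x) = - v x}

/-- `E(v) = ½ ∫ |v'|² + ¼ ∫ (W * (1 - |v|²)) (1 - |v|²)`. -/
def energy (W : SignedMeasure ℝ) (v : ℝ → ℂ) : ℝ :=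
  1 / 2 * (∫ x, ‖weakDeriv v x‖ ^ 2) + 1 / 4 * ∫ x, conv W (eta v) x * eta v x

/-- `u ∈ H¹_loc(ℝ)` solves `u'' + u (W * (1 - |u|²)) = 0` on `ℝ` in the weak sense:
`∫ u' φ' = ∫ (W * (1 - |u|²)) u φ` for all `φ ∈ C¹_c(ℝ)`. -/
def IsStaticSolution (W : SignedMeasure ℝ) (u : ℝ → ℂ) : Prop :=
  MemH1loc u ∧
    ∀ φ : ℝ → ℝ, ContDiff ℝ 1 φ → HasCompactSupport φ →
      ∫ x, deriv φ x • weakDeriv u x = ∫ x, (φ x * conv W (eta u) x) • u x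

/-- A black soliton: a finite energy solution of the static equation (represented by a continuous
function) that vanishes at some point. -/
def IsBlackSoliton (W : SignedMeasure ℝ) (u : ℝ → ℂ) : Prop :=
  u ∈ energySpace ∧ Continuous u ∧ IsStaticSolution W u ∧ ∃ x, u x = 0

end NonlocalGP

end

/-! The proof is the direct method, carried out on the derivative. An odd finite-energy function is,
up to null sets, `primitive g` with `g` in `L²`, so it vanishes at `0`, and with `η = 1 - |v|²` its
energy is `½‖g‖² + ¼Q(η)`, where `Q(f) = ∫ (W * f) f`.

By Plancherel `Q` has symbol `Ŵ ≥ 0`, hence is nonnegative and convex (`pairing_self_nonneg`).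
Coercivity is harder, as `Ŵ` may vanish at high frequency. There `Ŵ ≥ (1 - κξ²)⁺` gives `1 ≤ Ŵ +
(2κ+1)(1 - e^{-ξ²/2})`, so `‖η‖² ≤ Q(η) + C‖η'‖²` (`exists_norm_sq_le_pairing`). Since `η' = -2vv'`
and `sup |v|²` grows at most linearly in `‖η‖` (`primitive_sq_le`), this is a quadratic inequality
that bounds `‖η‖` by the energy.

Along a minimizing sequence `g` and `η` then converge weakly and the primitives converge pointwise.
This identifies the limit of `η`, and convexity gives lower semicontinuity. The minimizer is
critical for odd perturbations. Evenness of `W` makes both sides of the equation vanish on even test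
functions, so criticality extends to all of them. -/

noncomputable section

namespace NonlocalGP

open scoped RealInnerProductSpace SchwartzMap FourierTransform
open Filter Topology

/-! ### Translations of `L²` averaged against a finite measure -/

section Shift

variable {E : Type*} [NormedAddCommGroup E] [InnerProductSpace ℝ E]

/-- Translation `f ↦ f (· - y)` as a linear isometry of `L²(ℝ; E)`. -/
def translate (y : ℝ) : Lp E 2 (volume : Measure ℝ) →ₗᵢ[ℝ] Lp E 2 (volume : Measure ℝ) :=
  Lp.compMeasurePreservingₗᵢ ℝ (fun x => x - y) (measurePreserving_sub_right volume y)

lemma coeFn_translate (y : ℝ) (f : Lp E 2 (volume : Measure ℝ)) :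
    translate y f =ᵐ[volume] fun x => f (x - y) :=
  Lp.coeFn_compMeasurePreserving f (measurePreserving_sub_right volume y)

lemma continuous_translate (f : Lp E 2 (volume : Measure ℝ)) :
    Continuous fun y : ℝ => translate y f := by
  let g : ℝ → C(ℝ, ℝ) := fun y => ⟨fun x => x - y, by fun_prop⟩
  have hg : Continuous g := ContinuousMap.continuous_of_continuous_uncurry _ (by
    simp only [g, Function.uncurry_def, ContinuousMap.coe_mk]; fun_prop)
  exact Continuous.compMeasurePreservingLp (f := fun _ : ℝ => f) (g := g) continuous_const hg
    (fun y => measurePreserving_sub_right volume y) (by simp)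

lemma abs_inner_translate_le (y : ℝ) (f h : Lp E 2 (volume : Measure ℝ)) :
    |⟪translate y f, h⟫| ≤ ‖f‖ * ‖h‖ := by
  simpa using abs_real_inner_le_norm (translate y f) h

variable (μ : Measure ℝ) [IsFiniteMeasure μ]

lemma integrable_inner_translate (f h : Lp E 2 (volume : Measure ℝ)) :
    Integrable (fun y => ⟪translate y f, h⟫) μ :=
  Integrable.of_bound
    ((continuous_translate f).inner continuous_const).aestronglyMeasurable (‖f‖ * ‖h‖)
    (.of_forall fun y => abs_inner_translate_le y f h)

/-- The bilinear form `(f, h) ↦ ∫ ⟪f (· - y), h⟫ dμ(y)` on `L²`. -/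
def shiftForm : Lp E 2 (volume : Measure ℝ) →L[ℝ] Lp E 2 (volume : Measure ℝ) →L[ℝ] ℝ :=
  LinearMap.mkContinuous₂
    (LinearMap.mk₂ ℝ (fun f h => ∫ y, ⟪translate y f, h⟫ ∂μ)
      (fun f g h => by
        simp only [map_add, inner_add_left]
        exact integral_add (integrable_inner_translate μ f h) (integrable_inner_translate μ g h))
      (fun c f h => by
        simp only [map_smul, real_inner_smul_left, integral_const_mul, smul_eq_mul])
      (fun f g h => by
        simp only [inner_add_right]
        exact integral_add (integrable_inner_translate μ f g) (integrable_inner_translate μ f h))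
      (fun c f h => by
        simp only [real_inner_smul_right, integral_const_mul, smul_eq_mul]))
    (μ.real Set.univ) (fun f h => by
      simp only [LinearMap.mk₂_apply]
      refine (norm_integral_le_of_norm_le_const
        (.of_forall fun y => abs_inner_translate_le y f h)).trans (le_of_eq ?_)
      ring)

lemma shiftForm_apply (f h : Lp E 2 (volume : Measure ℝ)) :
    shiftForm μ f h = ∫ y, ⟪translate y f, h⟫ ∂μ := rfl

end Shift

/-! ### Plancherel and comparison of the quadratic forms -/

section Positivity

lemma translate_toLp (s : 𝓢(ℝ, ℂ)) (y : ℝ) :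
    translate y (s.toLp 2) = (s.compSubConstCLM ℝ y).toLp 2 := by
  apply Lp.ext
  have h := (measurePreserving_sub_right volume y).quasiMeasurePreserving.ae_eq_comp
    (s.coeFn_toLp 2 (volume : Measure ℝ))
  filter_upwards [coeFn_translate y (s.toLp 2), (s.compSubConstCLM ℝ y).coeFn_toLp 2 volume, h]
    with x h1 h2 h3
  rw [h1, h2]
  exact h3

/-- The transform `𝓕` uses the character `e^{-2πixξ}`, whereas `fourier W` uses `e^{-ixξ}`; hence
the frequency `2πξ` here and below. -/
lemma fourier_compSubConst (s : 𝓢(ℝ, ℂ)) (y ξ : ℝ) :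
    𝓕 (s.compSubConstCLM ℝ y) ξ = Complex.exp (-(Complex.I * y * (2 * Real.pi * ξ : ℝ))) * 𝓕 s ξ := by
  have := congrFun (VectorFourier.fourierIntegral_comp_add_right Real.fourierChar volume
    (innerₗ ℝ) (s : ℝ → ℂ) (-y)) ξ
  rw [SchwartzMap.fourier_coe, SchwartzMap.fourier_coe]
  refine (show _ = _ from this).trans ?_
  rw [Circle.smul_def, Real.fourierChar_apply, smul_eq_mul]
  congr 2
  simp
  ring

lemma inner_toLp_toLp (s t : 𝓢(ℝ, ℂ)) :
    ⟪s.toLp 2 (volume : Measure ℝ), t.toLp 2 (volume : Measure ℝ)⟫ =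
      (∫ x, inner ℂ (s x) (t x)).re := by
  have hint : Integrable (fun x => inner ℂ (s x) (t x)) volume := by
    refine (L2.integrable_inner (𝕜 := ℂ) (s.toLp 2 volume) (t.toLp 2 volume)).congr ?_
    filter_upwards [s.coeFn_toLp 2 volume, t.coeFn_toLp 2 volume] with x h1 h2
    rw [h1, h2]
  rw [L2.inner_def]
  refine Eq.trans ?_ (integral_re hint)
  refine integral_congr_ae ?_
  filter_upwards [s.coeFn_toLp 2 volume, t.coeFn_toLp 2 volume] with x h1 h2
  rw [h1, h2]
  rfl

lemma inner_translate_toLp (s : 𝓢(ℝ, ℂ)) (y : ℝ) :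
    ⟪translate y (s.toLp 2), s.toLp 2⟫ =
      ∫ ξ, (Complex.exp (-(Complex.I * y * (2 * Real.pi * ξ : ℝ)))).re * ‖𝓕 s ξ‖ ^ 2 := by
  rw [translate_toLp, inner_toLp_toLp, ← SchwartzMap.integral_inner_fourier_fourier]
  have hint : Integrable
      (fun ξ => inner ℂ (𝓕 (s.compSubConstCLM ℝ y) ξ) (𝓕 s ξ)) volume := by
    refine (L2.integrable_inner (𝕜 := ℂ) ((𝓕 (s.compSubConstCLM ℝ y)).toLp 2 volume)
      ((𝓕 s).toLp 2 volume)).congr ?_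
    filter_upwards [(𝓕 (s.compSubConstCLM ℝ y)).coeFn_toLp 2 volume,
      (𝓕 s).coeFn_toLp 2 volume] with x h1 h2
    rw [h1, h2]
  refine (integral_re hint).symm.trans (integral_congr_ae (.of_forall fun ξ => ?_))
  simp only [fourier_compSubConst]
  rw [← smul_eq_mul, inner_smul_left, inner_self_eq_norm_sq_to_K]
  simp only [RCLike.mul_re, ← RCLike.ofReal_pow, RCLike.ofReal_re, RCLike.ofReal_im, mul_zero,
    sub_zero, RCLike.conj_re, RCLike.re_to_complex]

/-- Plancherel turns each translation into multiplication by a unimodular factor, and Fubini sums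
these factors to the Fourier transform of `μ`. -/
lemma shiftForm_toLp (μ : Measure ℝ) [IsFiniteMeasure μ] (s : 𝓢(ℝ, ℂ)) :
    Integrable (fun ξ : ℝ => (∫ y, Complex.exp (-(Complex.I * y * (2 * Real.pi * ξ : ℝ))) ∂μ).re
      * ‖𝓕 s ξ‖ ^ 2) ∧
    shiftForm μ (s.toLp 2) (s.toLp 2) =
      ∫ ξ : ℝ, (∫ y, Complex.exp (-(Complex.I * y * (2 * Real.pi * ξ : ℝ))) ∂μ).re
        * ‖𝓕 s ξ‖ ^ 2 := by
  have hsq : Integrable (fun ξ => ‖𝓕 s ξ‖ ^ 2) volume :=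
    ((𝓕 s).memLp 2 volume).integrable_norm_pow (by norm_num)
  have hbound (y ξ : ℝ) :
      ‖Complex.exp (-(Complex.I * y * (2 * Real.pi * ξ : ℝ)))‖ = 1 := by
    rw [Complex.norm_exp]; simp
  have hexp (ξ : ℝ) : Integrable
      (fun y : ℝ => Complex.exp (-(Complex.I * y * (2 * Real.pi * ξ : ℝ)))) μ :=
    Integrable.of_bound (by fun_prop) 1 (.of_forall fun y => (hbound y ξ).le)
  have hprod : Integrable (Function.uncurry fun y ξ : ℝ =>
      (Complex.exp (-(Complex.I * y * (2 * Real.pi * ξ : ℝ)))).re * ‖𝓕 s ξ‖ ^ 2)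
      (μ.prod volume) := by
    refine (hsq.comp_snd μ).mono' ?_ (.of_forall fun p => ?_)
    · have := (𝓕 s).continuous
      refine Continuous.aestronglyMeasurable ?_
      unfold Function.uncurry
      fun_prop
    · simp only [Function.uncurry, norm_mul, norm_pow, Real.norm_eq_abs]
      calc _ ≤ 1 * ‖𝓕 s p.2‖ ^ 2 := by
            rw [abs_norm]
            gcongr
            exact (Complex.abs_re_le_norm _).trans (hbound _ _).le
        _ = _ := one_mul _
  have hre (ξ : ℝ) : ∫ y, (Complex.exp (-(Complex.I * y * (2 * Real.pi * ξ : ℝ)))).re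
      * ‖𝓕 s ξ‖ ^ 2 ∂μ =
      (∫ y, Complex.exp (-(Complex.I * y * (2 * Real.pi * ξ : ℝ))) ∂μ).re * ‖𝓕 s ξ‖ ^ 2 := by
    rw [integral_mul_const]
    congr 1
    exact integral_re (hexp ξ)
  constructor
  · exact hprod.integral_prod_right.congr (.of_forall hre)
  · rw [shiftForm_apply]
    simp_rw [inner_translate_toLp]
    rw [integral_integral_swap hprod]
    exact integral_congr_ae (.of_forall hre)

/-- The quadratic form of `shiftForm` is monotone in the real part of the Fourier transform. -/
theorem shiftForm_self_le_of_re_fourier_le {μ ν : Measure ℝ} [IsFiniteMeasure μ]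
    [IsFiniteMeasure ν]
    (h : ∀ᵐ ξ : ℝ, (∫ x, Complex.exp (-(Complex.I * x * ξ)) ∂ν).re ≤
      (∫ x, Complex.exp (-(Complex.I * x * ξ)) ∂μ).re) (f : Lp ℂ 2 (volume : Measure ℝ)) :
    shiftForm ν f f ≤ shiftForm μ f f := by
  refine (SchwartzMap.denseRange_toLpCLM (F := ℂ) (μ := (volume : Measure ℝ)) (p := 2)
    (by simp)).induction_on f ?_ ?_
  · exact isClosed_le (by fun_prop) (by fun_prop)
  · intro s
    rw [SchwartzMap.toLpCLM_apply, (shiftForm_toLp ν s).2, (shiftForm_toLp μ s).2]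
    refine integral_mono_ae (shiftForm_toLp ν s).1 (shiftForm_toLp μ s).1 ?_
    -- The hypothesis holds only almost everywhere; the rescaling `ξ ↦ 2πξ` pulls null sets back to
    -- null sets.
    have hq : Measure.QuasiMeasurePreserving (fun ξ : ℝ => 2 * Real.pi * ξ) volume volume := by
      refine ⟨by fun_prop, ?_⟩
      rw [Real.map_volume_mul_left (by positivity)]
      exact Measure.smul_absolutelyContinuous
    filter_upwards [hq.ae h] with ξ hξ
    gcongr

/-- The real-valued version of `shiftForm_self_le_of_re_fourier_le`. -/
theorem shiftForm_self_le_of_re_fourier_le_real {μ ν : Measure ℝ} [IsFiniteMeasure μ]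
    [IsFiniteMeasure ν]
    (h : ∀ᵐ ξ : ℝ, (∫ x, Complex.exp (-(Complex.I * x * ξ)) ∂ν).re ≤
      (∫ x, Complex.exp (-(Complex.I * x * ξ)) ∂μ).re) (f : Lp ℝ 2 (volume : Measure ℝ)) :
    shiftForm ν f f ≤ shiftForm μ f f := by
  have key := shiftForm_self_le_of_re_fourier_le h (Complex.ofRealCLM.compLp f)
  have hin (y : ℝ) : ⟪translate y (Complex.ofRealCLM.compLp f), Complex.ofRealCLM.compLp f⟫ =
      ⟪translate y f, f⟫ := by
    rw [L2.inner_def, L2.inner_def]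
    refine integral_congr_ae ?_
    have h3 := (measurePreserving_sub_right volume y).quasiMeasurePreserving.ae_eq_comp
      (Complex.ofRealCLM.coeFn_compLp' f)
    filter_upwards [coeFn_translate y f, coeFn_translate y (Complex.ofRealCLM.compLp f),
      Complex.ofRealCLM.coeFn_compLp' f, h3] with x h1 h2 h4 h5
    rw [h1, h2, h4]
    simp only [Function.comp_apply] at h5
    rw [h5]
    simp [Complex.inner]
  simpa only [shiftForm_apply, hin] using key

end Positivity

/-! ### Symmetry, and Fubini for convolutions -/

section ShiftReal

/-- The adjoint of translation by `y` is translation by `-y`, and `μ` is reflection invariant. -/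
lemma shiftForm_symm {μ : Measure ℝ} [IsFiniteMeasure μ] (hμ : μ.map Neg.neg = μ)
    (f h : Lp ℝ 2 (volume : Measure ℝ)) : shiftForm μ f h = shiftForm μ h f := by
  have hneg (y : ℝ) : ⟪translate (-y) f, h⟫ = ⟪translate y h, f⟫ := by
    have h1 : translate y (translate (-y) f) = f := by
      apply Lp.ext
      have h2 := (measurePreserving_sub_right volume y).quasiMeasurePreserving.ae_eq_comp
        (coeFn_translate (-y) f)
      filter_upwards [coeFn_translate y (translate (-y) f), h2] with x h3 h4
      rw [h3]
      simpa using h4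
    rw [← (translate y).inner_map_map (translate (-y) f) h, h1, real_inner_comm]
  rw [shiftForm_apply, shiftForm_apply]
  conv_lhs => rw [← hμ]
  rw [integral_map (by fun_prop)
    ((continuous_translate f).inner continuous_const).aestronglyMeasurable]
  simp only [hneg]

variable (μ : Measure ℝ) [IsFiniteMeasure μ]

lemma integrable_shift_mul {f h : ℝ → ℝ} (hf : MemLp f 2) (hh : MemLp h 2) :
    Integrable (fun p : ℝ × ℝ => f (p.1 - p.2) * h p.1) (volume.prod μ) := by
  have hmeas : AEStronglyMeasurable (fun p : ℝ × ℝ => f (p.1 - p.2) * h p.1)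
      (volume.prod μ) :=
    (hf.1.comp_quasiMeasurePreserving
      (quasiMeasurePreserving_sub_of_right_invariant volume μ)).mul hh.1.comp_fst
  rw [integrable_prod_iff' hmeas]
  have hfy (y : ℝ) : MemLp (fun x => f (x - y)) 2 :=
    hf.comp_measurePreserving (measurePreserving_sub_right volume y)
  constructor
  · exact .of_forall fun y => (hfy y).integrable_mul hh
  -- The inner integral of the absolute value is a translated inner product of `|f|` and `|h|`,
  -- which is bounded in `y`.
  · refine (integrable_inner_translate μ hf.norm.toLp hh.norm.toLp).congr
      (.of_forall fun y => ?_)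
    simp only [L2.inner_def]
    refine integral_congr_ae ?_
    have h2 := (measurePreserving_sub_right volume y).quasiMeasurePreserving.ae_eq_comp
      hf.norm.coeFn_toLp
    filter_upwards [coeFn_translate y hf.norm.toLp, h2, hh.norm.coeFn_toLp] with x h3 h4 h5
    simp only [Function.comp_apply] at h4
    rw [h3, h4, h5, norm_mul]
    simp [mul_comm]

lemma integral_shift_mul {f h : ℝ → ℝ} (hf : MemLp f 2) (hh : MemLp h 2) :
    ∫ x, (∫ y, f (x - y) ∂μ) * h x = shiftForm μ hf.toLp hh.toLp := by
  simp_rw [← integral_mul_const]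
  rw [integral_integral_swap (integrable_shift_mul μ hf hh), shiftForm_apply]
  congr 1 with y
  rw [L2.inner_def]
  refine integral_congr_ae ?_
  have h2 := (measurePreserving_sub_right volume y).quasiMeasurePreserving.ae_eq_comp
    hf.coeFn_toLp
  filter_upwards [coeFn_translate y hf.toLp, h2, hh.coeFn_toLp] with x h3 h4 h5
  simp only [Function.comp_apply] at h4
  rw [h3, h4, h5]
  simp [mul_comm]

end ShiftReal

/-! ### The form `∫ (W * f) h`: symmetry, positivity, coercivity -/

section Pairing

variable (W : SignedMeasure ℝ)

/-- The bilinear form `(f, h) ↦ ∫ (W * f) h` on `L²(ℝ)`. -/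
def pairing : Lp ℝ 2 (volume : Measure ℝ) →L[ℝ] Lp ℝ 2 (volume : Measure ℝ) →L[ℝ] ℝ :=
  shiftForm W.toJordanDecomposition.posPart - shiftForm W.toJordanDecomposition.negPart

lemma integral_conv_mul {f h : ℝ → ℝ} (hf : MemLp f 2) (hh : MemLp h 2) :
    ∫ x, conv W f x * h x = pairing W hf.toLp hh.toLp := by
  simp only [conv, sub_mul, pairing, sub_apply]
  rw [← integral_shift_mul _ hf hh, ← integral_shift_mul _ hf hh]
  refine integral_sub ?_ ?_
  · simp_rw [← integral_mul_const]
    exact (integrable_shift_mul _ hf hh).integral_prod_left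
  · simp_rw [← integral_mul_const]
    exact (integrable_shift_mul _ hf hh).integral_prod_left

/-- Even when `W` is singular, `(x, y) ↦ x - y` pulls Lebesgue null sets back to null sets of the
product measure. -/
lemma conv_congr_ae {f g : ℝ → ℝ} (h : f =ᵐ[volume] g) : conv W f =ᵐ[volume] conv W g := by
  have key (μ : Measure ℝ) [IsFiniteMeasure μ] :
      ∀ᵐ x, ∫ y, f (x - y) ∂μ = ∫ y, g (x - y) ∂μ := by
    have h1 := (quasiMeasurePreserving_sub_of_right_invariant volume μ).ae_eq_comp h
    filter_upwards [Measure.ae_ae_of_ae_prod h1] with x hx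
    exact integral_congr_ae hx
  filter_upwards [key W.toJordanDecomposition.posPart, key W.toJordanDecomposition.negPart]
    with x h1 h2
  rw [conv, conv, h1, h2]

variable {W}

/-- The reflected parts again form a Jordan decomposition of `W`, so uniqueness applies. -/
lemma IsEven.map_neg (hW : IsEven W) :
    W.toJordanDecomposition.posPart.map Neg.neg = W.toJordanDecomposition.posPart ∧
      W.toJordanDecomposition.negPart.map Neg.neg = W.toJordanDecomposition.negPart := by
  let j := W.toJordanDecomposition
  let j' : JordanDecomposition ℝ :=
    { posPart := j.posPart.map Neg.neg
      negPart := j.negPart.map Neg.neg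
      mutuallySingular := by
        obtain ⟨s, hs, h1, h2⟩ := j.mutuallySingular
        refine ⟨Neg.neg ⁻¹' s, measurable_neg hs, ?_, ?_⟩
        · rw [Measure.map_apply measurable_neg (measurable_neg hs)]
          simpa using h1
        · rw [← Set.preimage_compl, Measure.map_apply measurable_neg (measurable_neg hs.compl)]
          simpa using h2 }
  have hj : j' = j := by
    apply JordanDecomposition.toSignedMeasure_injective
    rw [SignedMeasure.toSignedMeasure_toJordanDecomposition]
    ext A hA
    rw [← hW A hA]
    conv_rhs => rw [← SignedMeasure.toSignedMeasure_toJordanDecomposition W]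
    simp only [JordanDecomposition.toSignedMeasure]
    rw [Measure.toSignedMeasure_sub_apply hA, Measure.toSignedMeasure_sub_apply (measurable_neg hA)]
    simp only [j', Measure.real]
    rw [Measure.map_apply measurable_neg hA, Measure.map_apply measurable_neg hA]
  exact ⟨congrArg JordanDecomposition.posPart hj, congrArg JordanDecomposition.negPart hj⟩

lemma IsEven.pairing_symm (hW : IsEven W) (f h : Lp ℝ 2 (volume : Measure ℝ)) :
    pairing W f h = pairing W h f := by
  simp only [pairing, sub_apply]
  rw [shiftForm_symm hW.map_neg.1, shiftForm_symm hW.map_neg.2]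

lemma IsEven.conv_neg (hW : IsEven W) {f : ℝ → ℝ} (hf : ∀ x, f (-x) = f x) (x : ℝ) :
    conv W f (-x) = conv W f x := by
  have key {μ : Measure ℝ} (hμ : μ.map Neg.neg = μ) :
      ∫ y, f (-x - y) ∂μ = ∫ y, f (x - y) ∂μ := by
    conv_lhs => rw [← hμ]
    refine ((MeasurableEquiv.neg ℝ).measurableEmbedding.integral_map
      (fun y => f (-x - y)) (μ := μ)).trans ?_
    congr 1 with y
    rw [← hf]
    congr 1
    simp
    ring
  rw [conv, conv, key hW.map_neg.1, key hW.map_neg.2]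

lemma integrable_exp_neg_I_mul (μ : Measure ℝ) [IsFiniteMeasure μ] (ξ : ℝ) :
    Integrable (fun x : ℝ => Complex.exp (-(Complex.I * x * ξ))) μ :=
  Integrable.of_bound (by fun_prop) 1 (.of_forall fun y => by rw [Complex.norm_exp]; simp)

lemma pairing_self_nonneg (hκ : FourierLowerBound W) (f : Lp ℝ 2 (volume : Measure ℝ)) :
    0 ≤ pairing W f f := by
  obtain ⟨κ, -, h⟩ := hκ
  simp only [pairing, sub_apply, sub_nonneg]
  apply shiftForm_self_le_of_re_fourier_le_real
  filter_upwards [h] with ξ hξ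
  have := (le_max_right _ _).trans hξ
  rwa [fourier, Complex.sub_re, sub_nonneg] at this

open ProbabilityTheory

lemma fourier_gaussianReal (ξ : ℝ) :
    (∫ x, Complex.exp (-(Complex.I * x * ξ)) ∂(gaussianReal 0 1)).re = Real.exp (-ξ ^ 2 / 2) := by
  have h := charFun_gaussianReal (μ := 0) (v := 1) (-ξ)
  rw [charFun_apply_real] at h
  have h2 : ∀ x : ℝ, Complex.exp (-(Complex.I * x * ξ)) =
      Complex.exp ((-ξ : ℝ) * x * Complex.I) := fun x => by
    congr 1; push_cast; ring
  simp_rw [h2, h]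
  rw [← Complex.ofReal_re (Real.exp (-ξ ^ 2 / 2))]
  congr 1
  push_cast
  congr 1
  simp
  ring

lemma integral_sq_gaussianReal : ∫ x, x ^ 2 ∂(gaussianReal 0 1) = 1 := by
  have h := variance_id_gaussianReal (μ := 0) (v := 1)
  rw [variance_of_integral_eq_zero (by fun_prop) (by simp [integral_id_gaussianReal])] at h
  simpa using h

lemma integrable_sq_gaussianReal : Integrable (fun x : ℝ => x ^ 2) (gaussianReal 0 1) := by
  simpa using (memLp_id_gaussianReal (μ := 0) (v := 1) 2).integrable_sq

/-- With `s = ξ²/2`, the left side `m` satisfies `m ≤ 2κs` and `m ≤ 1`, so `m(1 + s) ≤ (2κ + 1)s`;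
and `e^{-s} ≤ 1/(1 + s)` gives `s ≤ (1 - e^{-s})(1 + s)`. -/
lemma min_le_mul_one_sub_exp {κ : ℝ} (hκ : 0 ≤ κ) (ξ : ℝ) :
    1 - max (1 - κ * ξ ^ 2) 0 ≤ (2 * κ + 1) * (1 - Real.exp (-ξ ^ 2 / 2)) := by
  set s := ξ ^ 2 / 2 with hs
  have hs0 : 0 ≤ s := by positivity
  have h1 : Real.exp (-ξ ^ 2 / 2) * (1 + s) ≤ 1 := by
    have h2 : 1 + s ≤ Real.exp s := by linarith [Real.add_one_le_exp s]
    have h3 : Real.exp (-ξ ^ 2 / 2) * Real.exp s = 1 := by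
      rw [← Real.exp_add, hs]; simp [neg_div]
    calc _ ≤ Real.exp (-ξ ^ 2 / 2) * Real.exp s := by gcongr
      _ = 1 := h3
  have h4 : ξ ^ 2 = 2 * s := by rw [hs]; ring
  set e := Real.exp (-ξ ^ 2 / 2)
  set m := 1 - max (1 - κ * ξ ^ 2) 0 with hm
  have hm1 : m ≤ 2 * κ * s := by
    have := le_max_left (1 - κ * ξ ^ 2) 0
    rw [h4] at this
    rw [hm, h4]
    linarith
  have hm2 : m ≤ 1 := by
    have := le_max_right (1 - κ * ξ ^ 2) 0
    linarith
  have h5 : m * (1 + s) ≤ ((2 * κ + 1) * (1 - e)) * (1 + s) := by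
    nlinarith [mul_le_mul_of_nonneg_left hm2 hs0, mul_le_mul_of_nonneg_left h1 hκ]
  exact le_of_mul_le_mul_right h5 (by linarith)

lemma shiftForm_add_measure (μ ν : Measure ℝ) [IsFiniteMeasure μ] [IsFiniteMeasure ν]
    (f h : Lp ℝ 2 (volume : Measure ℝ)) :
    shiftForm (μ + ν) f h = shiftForm μ f h + shiftForm ν f h := by
  simp only [shiftForm_apply]
  exact integral_add_measure (integrable_inner_translate μ f h) (integrable_inner_translate ν f h)

lemma shiftForm_smul_measure (c : NNReal) (μ : Measure ℝ) [IsFiniteMeasure μ]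
    (f h : Lp ℝ 2 (volume : Measure ℝ)) :
    shiftForm (c • μ) f h = c * shiftForm μ f h := by
  simp only [shiftForm_apply, integral_smul_nnreal_measure]
  rfl

lemma translate_zero (f : Lp ℝ 2 (volume : Measure ℝ)) : translate 0 f = f := by
  apply Lp.ext
  filter_upwards [coeFn_translate 0 f] with x hx
  rw [hx, sub_zero]

lemma shiftForm_dirac_zero (f : Lp ℝ 2 (volume : Measure ℝ)) :
    shiftForm (Measure.dirac 0) f f = ‖f‖ ^ 2 := by
  rw [shiftForm_apply, integral_dirac, translate_zero, real_inner_self_eq_norm_sq]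

/-- Coercivity up to a derivative term, `D` standing for `‖f'‖`. The symbol `1 - e^{-ξ²/2}` belongs
to `‖f‖²` minus the Gaussian average of `⟪translate y f, f⟫`, which finite variance controls by
`D²`. -/
lemma exists_norm_sq_le_pairing (hκ : FourierLowerBound W) :
    ∃ C : ℝ, 0 ≤ C ∧ ∀ (f : Lp ℝ 2 (volume : Measure ℝ)) (D : ℝ),
      (∀ y, ‖translate y f - f‖ ≤ |y| * D) → ‖f‖ ^ 2 ≤ pairing W f f + C * D ^ 2 := by
  obtain ⟨κ, hκ0, h⟩ := hκ
  let C : NNReal := ⟨2 * κ + 1, by positivity⟩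
  refine ⟨2 * κ + 1, by positivity, fun f D hD => ?_⟩
  -- The comparison `1 + C e^{-ξ²/2} ≤ Ŵ + C`, with the negative part of `W` moved across so that
  -- both sides are positive measures.
  have key := shiftForm_self_le_of_re_fourier_le_real
    (μ := W.toJordanDecomposition.posPart + C • Measure.dirac 0)
    (ν := W.toJordanDecomposition.negPart + Measure.dirac 0 + C • gaussianReal 0 1) (by
      filter_upwards [h] with ξ hξ
      rw [integral_add_measure (integrable_exp_neg_I_mul _ ξ) (integrable_exp_neg_I_mul _ ξ),
        integral_add_measure (integrable_exp_neg_I_mul _ ξ) (integrable_exp_neg_I_mul _ ξ),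
        integral_add_measure (integrable_exp_neg_I_mul _ ξ) (integrable_exp_neg_I_mul _ ξ),
        integral_smul_nnreal_measure, integral_smul_nnreal_measure, integral_dirac]
      simp only [NNReal.smul_def, Complex.add_re, Complex.smul_re, fourier_gaussianReal]
      have h1 := min_le_mul_one_sub_exp hκ0 ξ
      rw [fourier, Complex.sub_re] at hξ
      have hC : (C : ℝ) = 2 * κ + 1 := rfl
      rw [hC]
      simp only [Complex.ofReal_zero, mul_zero, zero_mul, neg_zero, Complex.exp_zero,
        Complex.one_re, smul_eq_mul]
      linarith) f
  rw [shiftForm_add_measure, shiftForm_add_measure, shiftForm_add_measure,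
    shiftForm_smul_measure, shiftForm_smul_measure, shiftForm_dirac_zero] at key
  have hC : (C : ℝ) = 2 * κ + 1 := rfl
  rw [hC] at key
  have hgauss : ‖f‖ ^ 2 - D ^ 2 ≤ shiftForm (gaussianReal 0 1) f f := by
    rw [shiftForm_apply]
    have h2 : ∫ y, (‖f‖ ^ 2 - D ^ 2 * y ^ 2) ∂(gaussianReal 0 1) = ‖f‖ ^ 2 - D ^ 2 := by
      rw [integral_sub (integrable_const _) (integrable_sq_gaussianReal.const_mul _),
        integral_const_mul, integral_sq_gaussianReal]
      simp
    rw [← h2]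
    refine integral_mono ((integrable_const _).sub (integrable_sq_gaussianReal.const_mul _))
      (integrable_inner_translate _ f f) fun y => ?_
    -- Polarization: `⟪translate y f, f⟫ = ‖f‖² - ½‖translate y f - f‖²`; the factor `½` is given
    -- away.
    have h3 := norm_sub_sq_real (translate y f) f
    have h4 : ‖translate y f - f‖ ^ 2 ≤ (|y| * D) ^ 2 := by
      gcongr
      exact hD y
    rw [mul_pow, sq_abs] at h4
    rw [LinearIsometry.norm_map] at h3
    dsimp only
    nlinarith [mul_nonneg (sq_nonneg y) (sq_nonneg D)]
  have h5 := mul_le_mul_of_nonneg_left hgauss (by positivity : (0 : ℝ) ≤ 2 * κ + 1)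
  simp only [pairing, sub_apply]
  linarith

end Pairing

/-! ### Primitives of `L²` functions and the a priori bound -/

section Primitive

/-- The primitive `x ↦ ∫₀ˣ g`. -/
def primitive (g : ℝ → ℝ) (x : ℝ) : ℝ := ∫ t in (0 : ℝ)..x, g t

lemma primitive_zero (g : ℝ → ℝ) : primitive g 0 = 0 := by simp [primitive]

lemma sq_integral_le {α : Type*} [MeasurableSpace α] {μ : Measure α} [IsFiniteMeasure μ]
    {g : α → ℝ} (hg : MemLp g 2 μ) :
    (∫ x, g x ∂μ) ^ 2 ≤ μ.real Set.univ * ∫ x, g x ^ 2 ∂μ := by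
  have hi := hg.integrable (by norm_num)
  -- Expansion of `∫ (g - t)² ≥ 0`; its discriminant is Cauchy–Schwarz.
  have h (t : ℝ) : 0 ≤ μ.real Set.univ * (t * t) + (-2 * ∫ x, g x ∂μ) * t + ∫ x, g x ^ 2 ∂μ := by
    have h0 : 0 ≤ ∫ x, (g x - t) ^ 2 ∂μ := integral_nonneg fun x => sq_nonneg _
    have h1 : ∀ x, (g x - t) ^ 2 = (g x ^ 2 - (2 * t) * g x) + t ^ 2 := fun x => by ring
    simp_rw [h1] at h0
    have h2 : Integrable (fun x => g x ^ 2 - 2 * t * g x) μ :=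
      hg.integrable_sq.sub (hi.const_mul _)
    rw [integral_add h2 (integrable_const _),
      integral_sub hg.integrable_sq (hi.const_mul _), integral_const_mul, integral_const,
      smul_eq_mul] at h0
    linarith
  have := discrim_le_zero h
  rw [discrim] at this
  linarith

variable {g : ℝ → ℝ}

lemma locallyIntegrable_of_memLp (hg : MemLp g 2) : LocallyIntegrable g :=
  hg.locallyIntegrable (by norm_num)

lemma intervalIntegrable_of_memLp (hg : MemLp g 2) (a b : ℝ) :
    IntervalIntegrable g volume a b :=
  ((locallyIntegrable_of_memLp hg).integrableOn_isCompact isCompact_uIcc).intervalIntegrable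

lemma primitive_sub (hg : MemLp g 2) (a b : ℝ) :
    primitive g b - primitive g a = ∫ t in a..b, g t :=
  intervalIntegral.integral_interval_sub_left (intervalIntegrable_of_memLp hg _ _)
    (intervalIntegrable_of_memLp hg _ _)

lemma sq_intervalIntegral_le (hg : MemLp g 2) (a b : ℝ) :
    (∫ t in a..b, g t) ^ 2 ≤ |b - a| * ∫ t in Set.uIoc a b, g t ^ 2 := by
  rw [← sq_abs, intervalIntegral.abs_intervalIntegral_eq, sq_abs]
  have : IsFiniteMeasure (volume.restrict (Set.uIoc a b)) :=
    ⟨by rw [Measure.restrict_apply_univ, Set.uIoc]; exact measure_Ioc_lt_top⟩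
  refine (sq_integral_le (hg.restrict _)).trans (le_of_eq ?_)
  congr 1
  rw [measureReal_restrict_apply_univ, Set.uIoc, Real.volume_real_Ioc]
  rw [max_sub_min_eq_abs, max_eq_left (abs_nonneg _)]

lemma sq_primitive_sub_le (hg : MemLp g 2) (a b : ℝ) :
    (primitive g b - primitive g a) ^ 2 ≤ |b - a| * ∫ t, g t ^ 2 := by
  rw [primitive_sub hg]
  refine (sq_intervalIntegral_le hg a b).trans ?_
  refine mul_le_mul_of_nonneg_left ?_ (abs_nonneg _)
  exact setIntegral_le_integral hg.integrable_sq (.of_forall fun x => sq_nonneg _)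

lemma continuous_primitive_of_memLp (hg : MemLp g 2) : Continuous (primitive g) :=
  intervalIntegral.continuous_primitive (intervalIntegrable_of_memLp hg) 0

/-- Cauchy–Schwarz on an interval of length `|y|`, then Tonelli. The lower integral avoids
presupposing that the increment is square integrable. -/
lemma lintegral_sq_shift_primitive_sub_le (hg : MemLp g 2) (y : ℝ) :
    ∫⁻ x, ENNReal.ofReal ((primitive g (x - y) - primitive g x) ^ 2) ≤
      ENNReal.ofReal (y ^ 2 * ∫ t, g t ^ 2) := by
  let U := Set.uIoc 0 y
  have hshift (x : ℝ) : MemLp (fun s => g (x - s)) 2 :=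
    hg.comp_measurePreserving (Measure.measurePreserving_sub_left volume x)
  have h1 (x : ℝ) : ENNReal.ofReal ((primitive g (x - y) - primitive g x) ^ 2) ≤
      ENNReal.ofReal |y| * ∫⁻ s in U, ENNReal.ofReal (g (x - s) ^ 2) := by
    rw [← ofReal_integral_eq_lintegral_ofReal (hshift x).integrable_sq.integrableOn
      (.of_forall fun _ => sq_nonneg _), ← ENNReal.ofReal_mul (abs_nonneg _)]
    refine ENNReal.ofReal_le_ofReal ?_
    have h2 := sq_intervalIntegral_le (hshift x) 0 y
    rw [sub_zero, intervalIntegral.integral_comp_sub_left (fun t => g t), sub_zero,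
      ← primitive_sub hg] at h2
    calc _ = (primitive g x - primitive g (x - y)) ^ 2 := by ring
      _ ≤ _ := h2
  have hmeas : AEMeasurable (Function.uncurry fun x s : ℝ => ENNReal.ofReal (g (x - s) ^ 2))
      (volume.prod (volume.restrict U)) :=
    ((hg.1.comp_quasiMeasurePreserving (quasiMeasurePreserving_sub_of_right_invariant volume
      (volume.restrict U))).aemeasurable.pow_const 2).ennreal_ofReal
  calc _ ≤ ∫⁻ x, ENNReal.ofReal |y| * ∫⁻ s in U, ENNReal.ofReal (g (x - s) ^ 2) :=
        lintegral_mono h1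
    _ = ENNReal.ofReal |y| * ∫⁻ s in U, ∫⁻ x, ENNReal.ofReal (g (x - s) ^ 2) := by
        rw [lintegral_const_mul' _ _ ENNReal.ofReal_ne_top, lintegral_lintegral_swap hmeas]
    _ = ENNReal.ofReal |y| * ∫⁻ s in U, ENNReal.ofReal (∫ t, g t ^ 2) := by
        congr 2 with s
        rw [lintegral_sub_right_eq_self (fun x => ENNReal.ofReal (g x ^ 2)) s,
          ofReal_integral_eq_lintegral_ofReal hg.integrable_sq
            (.of_forall fun _ => sq_nonneg _)]
    _ = ENNReal.ofReal (y ^ 2 * ∫ t, g t ^ 2) := by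
        rw [lintegral_const, Measure.restrict_apply_univ, Real.volume_uIoc, sub_zero, mul_comm,
          mul_assoc, ← ENNReal.ofReal_mul (abs_nonneg _), abs_mul_abs_self,
          ← ENNReal.ofReal_mul (integral_nonneg fun _ => sq_nonneg _)]
        congr 1
        ring

lemma norm_toLp_sq {f : ℝ → ℝ} (hf : MemLp f 2) : ‖hf.toLp‖ ^ 2 = ∫ x, f x ^ 2 := by
  rw [← real_inner_self_eq_norm_sq (hf.toLp f), L2.inner_def]
  refine integral_congr_ae ?_
  filter_upwards [hf.coeFn_toLp] with x hx
  rw [hx]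
  simp [sq]

lemma inner_toLp_real {f h : ℝ → ℝ} (hf : MemLp f 2) (hh : MemLp h 2) :
    ⟪hf.toLp, hh.toLp⟫ = ∫ x, f x * h x := by
  rw [L2.inner_def]
  refine integral_congr_ae ?_
  filter_upwards [hf.coeFn_toLp, hh.coeFn_toLp] with x hx hy
  rw [hx, hy]
  simp [mul_comm]

lemma norm_translate_sub_le (hg : MemLp g 2) {f : ℝ → ℝ} (hf : MemLp f 2 volume) {K : ℝ} (hK : 0 ≤ K)
    (h : ∀ a b, |f a - f b| ≤ K * |primitive g a - primitive g b|) (y : ℝ) :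
    ‖translate y hf.toLp - hf.toLp‖ ≤ |y| * (K * ‖hg.toLp‖) := by
  have hfy : MemLp (fun x => f (x - y)) 2 :=
    hf.comp_measurePreserving (measurePreserving_sub_right volume y)
  have heq : translate y hf.toLp - hf.toLp = (hfy.sub hf).toLp := by
    apply Lp.ext
    have h2 := (measurePreserving_sub_right volume y).quasiMeasurePreserving.ae_eq_comp
      hf.coeFn_toLp
    filter_upwards [Lp.coeFn_sub (translate y hf.toLp) hf.toLp, coeFn_translate y hf.toLp, h2,
      hf.coeFn_toLp, (hfy.sub hf).coeFn_toLp] with x h3 h4 h5 h6 h7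
    simp only [Function.comp_apply] at h5
    rw [h3, h7, Pi.sub_apply, Pi.sub_apply, h4, h5, h6]
  refine (abs_le_of_sq_le_sq' ?_ (by positivity)).2
  rw [heq, norm_toLp_sq, mul_pow, mul_pow, sq_abs, norm_toLp_sq]
  have hnn : 0 ≤ y ^ 2 * (K ^ 2 * ∫ x, g x ^ 2) :=
    mul_nonneg (sq_nonneg _) (mul_nonneg (sq_nonneg _) (integral_nonneg fun _ => sq_nonneg _))
  rw [← ENNReal.ofReal_le_ofReal_iff hnn, ofReal_integral_eq_lintegral_ofReal
    (hfy.sub hf).integrable_sq (.of_forall fun _ => sq_nonneg _)]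
  calc _ ≤ ∫⁻ x, ENNReal.ofReal (K ^ 2) *
        ENNReal.ofReal ((primitive g (x - y) - primitive g x) ^ 2) := by
        refine lintegral_mono fun x => ?_
        rw [← ENNReal.ofReal_mul (sq_nonneg _)]
        refine ENNReal.ofReal_le_ofReal ?_
        rw [Pi.sub_apply, ← mul_pow, ← sq_abs, ← sq_abs (K * _), abs_mul K, abs_of_nonneg hK]
        gcongr
        exact h _ _
    _ ≤ ENNReal.ofReal (K ^ 2) * ENNReal.ofReal (y ^ 2 * ∫ t, g t ^ 2) := by
        rw [lintegral_const_mul' _ _ ENNReal.ofReal_ne_top]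
        gcongr
        exact lintegral_sq_shift_primitive_sub_le hg y
    _ = _ := by
        rw [← ENNReal.ofReal_mul (sq_nonneg _)]
        congr 1
        ring

/-- Integration by parts for absolutely continuous functions; Lebesgue differentiation identifies
the derivative of the primitive with `g`. -/
lemma integral_deriv_mul_primitive (hg : MemLp g 2) {φ : ℝ → ℝ} (hφ : ContDiff ℝ 1 φ)
    (hc : HasCompactSupport φ) :
    ∫ x, deriv φ x * primitive g x = -∫ x, φ x * g x := by
  obtain ⟨R, hR, hsub⟩ := hc.isBounded.subset_ball_lt 0 0
  have hz : ∀ x, x ∉ Set.Ioo (-R) R → φ x = 0 := fun x hx => by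
    refine image_eq_zero_of_notMem_tsupport fun h => hx ?_
    simpa [abs_lt] using hsub h
  have hsupp : Function.support φ ⊆ Set.Ioc (-R) R := fun x hx => by
    by_contra h
    exact hx (hz x fun h' => h ⟨h'.1, h'.2.le⟩)
  have hsupp' : Function.support (deriv φ) ⊆ Set.Ioc (-R) R := fun x hx => by
    have := hsub ((support_deriv_subset (f := φ)) hx)
    rw [Real.ball_eq_Ioo] at this
    exact ⟨by linarith [this.1], by linarith [this.2]⟩
  have hw : AbsolutelyContinuousOnInterval (primitive g) (-R) R :=
    (intervalIntegrable_of_memLp hg (-R) R).absolutelyContinuousOnInterval_intervalIntegral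
      (by rw [Set.uIcc_of_le (by linarith)]; constructor <;> linarith)
  have hφa : AbsolutelyContinuousOnInterval φ (-R) R :=
    hφ.contDiffOn.absolutelyContinuousOnInterval
  have key := hφa.integral_mul_deriv_eq_deriv_mul hw
  rw [hz R (by simp), hz (-R) (by simp), zero_mul, zero_mul, sub_zero, zero_sub,
    intervalIntegral.integral_eq_integral_of_support_subset
      (f := fun x => deriv φ x * primitive g x)
      ((Function.support_mul_subset_left _ _).trans hsupp'),
    intervalIntegral.integral_eq_integral_of_support_subset
      (f := fun x => φ x * deriv (primitive g) x)
      ((Function.support_mul_subset_left _ _).trans hsupp)] at key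
  rw [eq_neg_iff_add_eq_zero, add_comm, ← eq_neg_iff_add_eq_zero, ← key]
  refine integral_congr_ae ?_
  filter_upwards [_root_.LocallyIntegrable.ae_hasDerivAt_integral (locallyIntegrable_of_memLp hg)] with x hx
  rw [(hx 0).deriv.symm]
  rfl

/-- On a unit interval the primitive varies by at most `G = ‖g‖`. A value `m ≥ G + 1` thus forces it
to stay above `m - G ≥ 1` in modulus there, which costs `(m - G)² - 1 ≤ ‖η‖`. Linear growth in `‖η‖`
is what the a priori bound needs. -/
lemma primitive_sq_le (hg : MemLp g 2) (hη : MemLp (fun x => 1 - primitive g x ^ 2) 2) (x : ℝ) :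
    primitive g x ^ 2 ≤ 2 * ‖hg.toLp‖ ^ 2 + 2 + 2 * ‖hη.toLp‖ := by
  set G := ‖hg.toLp‖
  set N := ‖hη.toLp‖
  have hG : 0 ≤ G := norm_nonneg _
  have hN : 0 ≤ N := norm_nonneg _
  set m := |primitive g x| with hm
  rw [← sq_abs, ← hm]
  have hm0 : 0 ≤ m := abs_nonneg _
  rcases le_total m (G + 1) with h | h
  · nlinarith [sq_nonneg (G - 1)]
  have hlow : ∀ t ∈ Set.Icc x (x + 1), m - G ≤ |primitive g t| := fun t ht => by
    have h1 := sq_primitive_sub_le hg t x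
    rw [← norm_toLp_sq hg] at h1
    have h2 : |x - t| ≤ 1 := by rw [abs_le]; constructor <;> linarith [ht.1, ht.2]
    have h3 : |primitive g x - primitive g t| ≤ G := by
      refine abs_le_of_sq_le_sq (h1.trans ?_) hG
      calc |x - t| * G ^ 2 ≤ 1 * G ^ 2 := by gcongr
        _ = G ^ 2 := one_mul _
    have h4 := abs_sub_abs_le_abs_sub (primitive g x) (primitive g t)
    linarith
  have hsq : ((m - G) ^ 2 - 1) ^ 2 ≤ N ^ 2 := by
    rw [norm_toLp_sq hη]
    calc ((m - G) ^ 2 - 1) ^ 2 = ∫ t in Set.Icc x (x + 1), ((m - G) ^ 2 - 1) ^ 2 := by simp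
      _ ≤ ∫ t in Set.Icc x (x + 1), (1 - primitive g t ^ 2) ^ 2 := by
          refine setIntegral_mono_on (integrableOn_const (by simp))
            hη.integrable_sq.integrableOn measurableSet_Icc fun t ht => ?_
          have h1 := hlow t ht
          have h2 : (m - G) ^ 2 ≤ primitive g t ^ 2 := by
            rw [← sq_abs (primitive g t)]
            gcongr
            linarith
          have h3 : 1 ≤ (m - G) ^ 2 := by nlinarith
          nlinarith
      _ ≤ _ := setIntegral_le_integral hη.integrable_sq (.of_forall fun _ => sq_nonneg _)
  have h5 : (m - G) ^ 2 - 1 ≤ N := (abs_le_of_sq_le_sq' hsq hN).2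
  nlinarith [sq_nonneg (m - 2 * G)]

lemma exists_norm_le_of_energy_le {W : SignedMeasure ℝ} (hκ : FourierLowerBound W) (e : ℝ) :
    ∃ R : ℝ, ∀ {g : ℝ → ℝ} (hg : MemLp g 2) (hη : MemLp (fun x => 1 - primitive g x ^ 2) 2),
      1 / 2 * ‖hg.toLp‖ ^ 2 + 1 / 4 * pairing W hη.toLp hη.toLp ≤ e →
      ‖hg.toLp‖ ≤ R ∧ ‖hη.toLp‖ ≤ R ∧ ∀ x, |primitive g x| ≤ R := by
  obtain ⟨C, hC, hcoer⟩ := exists_norm_sq_le_pairing hκ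
  let e' := |e|
  -- Coefficients of `N² ≤ a + bN`, obtained from `Q(η) ≤ 4e'`, `G² ≤ 2e'` and `sup |v|² ≤ 2G² + 2 +
  -- 2N`.
  let a := 4 * e' + C * (4 * (2 * (2 * e') + 2) * (2 * e'))
  let b := C * (8 * (2 * e'))
  have he' : 0 ≤ e' := abs_nonneg _
  have ha : 0 ≤ a := by positivity
  have hb : 0 ≤ b := by positivity
  let B := 1 + a + b
  refine ⟨1 + 2 * e' + B + (2 * (2 * e') + 2 + 2 * B), fun {g} hg hη h => ?_⟩
  have hQ := pairing_self_nonneg hκ hη.toLp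
  set G := ‖hg.toLp‖
  set N := ‖hη.toLp‖
  have hG0 : 0 ≤ G := norm_nonneg _
  have hN0 : 0 ≤ N := norm_nonneg _
  have hee : e ≤ e' := le_abs_self _
  have hG : G ^ 2 ≤ 2 * e' := by linarith
  have hsup := primitive_sq_le hg hη
  set M2 := 2 * G ^ 2 + 2 + 2 * N
  have hM0 : 0 ≤ M2 := by positivity
  have hcont := hcoer hη.toLp (2 * √M2 * G) (norm_translate_sub_le hg hη (by positivity)
    fun s t => by
      have h1 : |primitive g s| ≤ √M2 := Real.abs_le_sqrt (hsup s)
      have h2 : |primitive g t| ≤ √M2 := Real.abs_le_sqrt (hsup t)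
      have h3 : (1 - primitive g s ^ 2) - (1 - primitive g t ^ 2) =
        -((primitive g s + primitive g t) * (primitive g s - primitive g t)) := by ring
      rw [h3, abs_neg, abs_mul]
      gcongr
      linarith [abs_add_le (primitive g s) (primitive g t)])
  have hD : (2 * √M2 * G) ^ 2 = 4 * M2 * G ^ 2 := by
    rw [mul_pow, mul_pow, Real.sq_sqrt hM0]; norm_num
  rw [hD] at hcont
  have h1 : 4 * M2 * G ^ 2 ≤ 4 * (2 * (2 * e') + 2 + 2 * N) * (2 * e') := by
    gcongr
    simp only [M2]
    linarith
  have h2 : N ^ 2 ≤ a + b * N := by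
    have := mul_le_mul_of_nonneg_left h1 hC
    simp only [a, b]
    nlinarith
  have hN : N ≤ B := by
    rcases le_total N 1 with h3 | h3
    · simp only [B]; linarith
    · have h4 : N * N ≤ (a + b) * N := by nlinarith
      have h5 := le_of_mul_le_mul_right h4 (by linarith)
      simp only [B]; linarith
  have hB : 0 ≤ B := by positivity
  refine ⟨?_, ?_, fun x => ?_⟩
  · nlinarith [sq_nonneg (G - 1)]
  · linarith
  · have h3 := hsup x
    have h4 : primitive g x ^ 2 ≤ 2 * (2 * e') + 2 + 2 * B := by
      simp only [M2] at h3; linarith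
    rw [← sq_abs] at h4
    nlinarith [abs_nonneg (primitive g x), sq_nonneg (|primitive g x| - 1)]

end Primitive

/-! ### Weak derivatives and the passage to primitives -/

section WeakDerivative

lemma exists_contDiff_deriv_eq {ψ : ℝ → ℝ} (hψ : ContDiff ℝ ∞ ψ) (hc : HasCompactSupport ψ)
    (h0 : ∫ x, ψ x = 0) :
    ∃ φ : ℝ → ℝ, ContDiff ℝ ∞ φ ∧ HasCompactSupport φ ∧ deriv φ = ψ := by
  obtain ⟨R, hR, hsub⟩ := hc.isBounded.subset_ball_lt 0 0
  have hz : ∀ x, x ∉ Set.Ioo (-R) R → ψ x = 0 := fun x hx => by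
    refine image_eq_zero_of_notMem_tsupport fun h => hx ?_
    simpa [abs_lt] using hsub h
  have hcont := hψ.continuous
  let φ : ℝ → ℝ := fun x => ∫ t in (-R)..x, ψ t
  have hd : ∀ x, HasDerivAt φ (ψ x) x := fun x =>
    intervalIntegral.integral_hasDerivAt_right (hcont.intervalIntegrable _ _)
      hcont.aestronglyMeasurable.stronglyMeasurableAtFilter hcont.continuousAt
  have hderiv : deriv φ = ψ := funext fun x => (hd x).deriv
  refine ⟨φ, ?_, ?_, hderiv⟩
  · rw [contDiff_infty_iff_deriv, hderiv]
    exact ⟨fun x => (hd x).differentiableAt, hψ⟩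
  · refine HasCompactSupport.intro (isCompact_Icc (a := -R) (b := R)) fun x hx => ?_
    rcases le_total x (-R) with h | h
    · refine (intervalIntegral.integral_congr fun t ht => ?_).trans
        (intervalIntegral.integral_zero (a := -R) (b := x) (E := ℝ) (μ := volume))
      rw [Set.uIcc_of_ge h] at ht
      exact hz t fun h' => absurd h'.1 (not_lt.2 ht.2)
    · have hx2 : R < x := by
        by_contra h'
        exact hx ⟨h, not_lt.1 h'⟩
      refine (intervalIntegral.integral_eq_integral_of_support_subset fun t ht => ?_).trans h0
      by_contra h'
      exact ht (hz t fun h'' => h' ⟨h''.1, by linarith [h''.2]⟩)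

/-- A locally integrable function with vanishing weak derivative is a.e. constant. -/
lemma exists_ae_eq_const_of_integral_deriv_mul_eq_zero {f : ℝ → ℝ} (hf : LocallyIntegrable f)
    (h : ∀ φ : ℝ → ℝ, ContDiff ℝ ∞ φ → HasCompactSupport φ → ∫ x, deriv φ x * f x = 0) :
    ∃ c : ℝ, f =ᵐ[volume] fun _ => c := by
  -- With `χ` of integral one, `ψ - (∫ψ)χ` has mean zero and so is the derivative of a test
  -- function; the constant must be `∫ χ f`.
  let b : ContDiffBump (0 : ℝ) := ⟨1, 2, one_pos, one_lt_two⟩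
  let χ : ℝ → ℝ := b.normed volume
  have hχ : ContDiff ℝ ∞ χ := b.contDiff_normed
  have hχc : HasCompactSupport χ := b.hasCompactSupport_normed
  have hχ1 : ∫ x, χ x = 1 := b.integral_normed
  have hint {ψ : ℝ → ℝ} (hψ : ContDiff ℝ ∞ ψ) (hc : HasCompactSupport ψ) :
      Integrable (fun x => ψ x * f x) := by
    simpa only [smul_eq_mul] using hf.integrable_smul_left_of_hasCompactSupport hψ.continuous hc
  refine ⟨∫ x, χ x * f x, ae_eq_of_integral_contDiff_smul_eq hf
    continuous_const.locallyIntegrable fun ψ hψ hc => ?_⟩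
  have hψi : Integrable ψ := hψ.continuous.integrable_of_hasCompactSupport hc
  have hχi : Integrable χ := hχ.continuous.integrable_of_hasCompactSupport hχc
  have hs : ContDiff ℝ ∞ (fun x => (∫ t, ψ t) * χ x) := contDiff_const.mul hχ
  have hsc : HasCompactSupport (fun x => (∫ t, ψ t) * χ x) := hχc.mul_left
  obtain ⟨φ, hφ, hφc, hφd⟩ := exists_contDiff_deriv_eq
    (ψ := fun x => ψ x - (∫ t, ψ t) * χ x) (hψ.sub hs) (hc.sub hsc) (by
      rw [integral_sub hψi (hχi.const_mul _), integral_const_mul, hχ1]; ring)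
  have key := h φ hφ hφc
  rw [hφd] at key
  simp only [sub_mul] at key
  rw [integral_sub (hint hψ hc) (hint hs hsc)] at key
  simp only [mul_assoc] at key
  rw [integral_const_mul] at key
  simp only [smul_eq_mul]
  rw [integral_mul_const]
  linarith

lemma HasWeakDeriv.congr_left {v w g : ℝ → ℂ} (h : HasWeakDeriv v g) (hvw : v =ᵐ[volume] w) :
    HasWeakDeriv w g := by
  refine ⟨h.1.congr hvw, h.2.1, fun φ hφ hc => ?_⟩
  rw [← h.2.2 φ hφ hc]
  refine integral_congr_ae ?_
  filter_upwards [hvw] with x hx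
  rw [hx]

lemma HasWeakDeriv.ae_eq {v g h : ℝ → ℂ} (hg : HasWeakDeriv v g) (hh : HasWeakDeriv v h) :
    g =ᵐ[volume] h :=
  ae_eq_of_integral_contDiff_smul_eq hg.2.1 hh.2.1 fun φ hφ hc => by
    rw [← neg_inj, ← hg.2.2 φ hφ hc, hh.2.2 φ hφ hc]

lemma HasWeakDeriv.weakDeriv_ae_eq {v g : ℝ → ℂ} (hg : HasWeakDeriv v g) :
    weakDeriv v =ᵐ[volume] g := by
  have h : ∃ g, HasWeakDeriv v g := ⟨g, hg⟩
  rw [weakDeriv, dif_pos h]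
  exact h.choose_spec.ae_eq hg

variable {g : ℝ → ℝ}

lemma hasWeakDeriv_primitive (hg : MemLp g 2) :
    HasWeakDeriv (fun x => (primitive g x : ℂ)) (fun x => (g x : ℂ)) := by
  have hcont := continuous_primitive_of_memLp hg
  refine ⟨(by fun_prop : Continuous fun x => (primitive g x : ℂ)).locallyIntegrable, ?_, ?_⟩
  · exact hg.ofReal.locallyIntegrable (by norm_num)
  · intro φ hφ hc
    simp only [Complex.real_smul, ← Complex.ofReal_mul]
    rw [integral_complex_ofReal, integral_complex_ofReal,
      integral_deriv_mul_primitive hg (hφ.of_le (by norm_cast)) hc, Complex.ofReal_neg]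

lemma memL2loc_of_continuous {v : ℝ → ℂ} (hv : Continuous v) : MemL2loc v := fun K hK => by
  have : IsFiniteMeasure (volume.restrict K) := ⟨by simpa using hK.measure_lt_top⟩
  obtain ⟨C, hC⟩ := hK.exists_bound_of_continuousOn hv.continuousOn
  refine MemLp.of_bound hv.aestronglyMeasurable C ?_
  exact (ae_restrict_iff' hK.measurableSet).2 (.of_forall hC)

lemma eta_ofReal (w : ℝ → ℝ) : eta (fun x => (w x : ℂ)) = fun x => 1 - w x ^ 2 := by
  ext x
  simp [eta]

lemma primitive_mem_oddEnergySpace (hg : MemLp g 2)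
    (hodd : ∀ x, primitive g (-x) = -primitive g x)
    (hη : MemLp (fun x => 1 - primitive g x ^ 2) 2) :
    (fun x => (primitive g x : ℂ)) ∈ oddEnergySpace := by
  have hcont := continuous_primitive_of_memLp hg
  have hwd := hasWeakDeriv_primitive hg
  refine ⟨⟨⟨memL2loc_of_continuous (by fun_prop), _, hwd, fun K _ => hg.ofReal.restrict K⟩,
    ?_, ?_⟩, .of_forall fun x => by simp, .of_forall fun x => by simp [hodd]⟩
  · rwa [eta_ofReal]
  · exact hg.ofReal.ae_eq hwd.weakDeriv_ae_eq.symm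

lemma energy_eq (W : SignedMeasure ℝ) {v : ℝ → ℂ} (hg : MemLp g 2)
    (hη : MemLp (fun x => 1 - primitive g x ^ 2) 2)
    (hv : v =ᵐ[volume] fun x => (primitive g x : ℂ)) :
    energy W v = 1 / 2 * ‖hg.toLp‖ ^ 2 + 1 / 4 * pairing W hη.toLp hη.toLp := by
  have h1 : ∫ x, ‖weakDeriv v x‖ ^ 2 = ‖hg.toLp‖ ^ 2 := by
    rw [norm_toLp_sq]
    refine integral_congr_ae ?_
    filter_upwards [((hasWeakDeriv_primitive hg).congr_left hv.symm).weakDeriv_ae_eq] with x hx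
    rw [hx]
    simp
  have heta : eta v =ᵐ[volume] fun x => 1 - primitive g x ^ 2 := by
    filter_upwards [hv] with x hx
    simp [eta, hx]
  have h2 : ∫ x, conv W (eta v) x * eta v x = pairing W hη.toLp hη.toLp := by
    rw [← integral_conv_mul]
    refine integral_congr_ae ?_
    filter_upwards [heta, conv_congr_ae W heta] with x hx hx'
    rw [hx, hx']
  rw [energy, h1, h2]

/-- The real part of `v` differs from the primitive of its weak derivative by a constant, which
oddness kills. Minimization may therefore run over `g` alone. -/
lemma exists_primitive_of_mem_oddEnergySpace {v : ℝ → ℂ} (hv : v ∈ oddEnergySpace) :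
    ∃ g : ℝ → ℝ, MemLp g 2 ∧ (∀ x, primitive g (-x) = -primitive g x) ∧
      MemLp (fun x => 1 - primitive g x ^ 2) 2 ∧
      v =ᵐ[volume] fun x => (primitive g x : ℂ) := by
  obtain ⟨⟨⟨hvl, k, hk, -⟩, hη, hD⟩, him, hodd⟩ := hv
  have hkL : MemLp k 2 := hD.ae_eq hk.weakDeriv_ae_eq
  let g : ℝ → ℝ := fun x => (k x).re
  have hg : MemLp g 2 := hkL.re
  have hcont := continuous_primitive_of_memLp hg
  have hvre : LocallyIntegrable fun x => (v x).re := fun x => by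
    obtain ⟨s, hs, hi⟩ := hk.1 x
    exact ⟨s, hs, hi.re⟩
  have hlw : LocallyIntegrable (primitive g) := hcont.locallyIntegrable
  have hmulint {f : ℝ → ℝ} (hf : LocallyIntegrable f) {ψ : ℝ → ℝ} (hψ : Continuous ψ)
      (hc : HasCompactSupport ψ) : Integrable (fun x => ψ x * f x) := by
    simpa only [smul_eq_mul] using hf.integrable_smul_left_of_hasCompactSupport hψ hc
  obtain ⟨c, hc⟩ := exists_ae_eq_const_of_integral_deriv_mul_eq_zero
    (f := fun x => (v x).re - primitive g x) (hvre.sub hlw) fun φ hφ hφc => by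
      have hφ1 : ContDiff ℝ 1 φ := hφ.of_le (by norm_cast)
      have hdc : Continuous (deriv φ) := hφ1.continuous_deriv le_rfl
      simp only [mul_sub]
      rw [integral_sub (hmulint hvre hdc hφc.deriv) (hmulint hlw hdc hφc.deriv),
        integral_deriv_mul_primitive hg hφ1 hφc]
      have h1 := congrArg Complex.re (hk.2.2 φ hφ hφc)
      have hi1 : Integrable fun x => deriv φ x • v x :=
        hk.1.integrable_smul_left_of_hasCompactSupport hdc hφc.deriv
      have hi2 : Integrable fun x => φ x • k x :=
        hk.2.1.integrable_smul_left_of_hasCompactSupport hφ1.continuous hφc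
      have e1 := integral_re (𝕜 := ℂ) hi1
      have e2 := integral_re (𝕜 := ℂ) hi2
      simp only [RCLike.re_to_complex, Complex.smul_re, smul_eq_mul] at e1 e2
      rw [Complex.neg_re, ← e1, ← e2] at h1
      rw [h1]
      simp [g]
  have hvw : ∀ᵐ x, (v x).re = primitive g x + c := by
    filter_upwards [hc] with x hx
    linarith
  have hneg : ∀ᵐ x, (v (-x)).re = primitive g (-x) + c :=
    (Measure.measurePreserving_neg (volume : Measure ℝ)).quasiMeasurePreserving.ae hvw
  have hoddae : (fun x => primitive g (-x) + c) =ᵐ[volume] fun x => -(primitive g x + c) := by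
    filter_upwards [hvw, hneg, hodd] with x h1 h2 h3
    rw [← h1, ← h2, h3, Complex.neg_re]
  -- Continuity upgrades oddness from almost everywhere to everywhere, so it can be evaluated at
  -- `0`.
  have hoddall := (Continuous.ae_eq_iff_eq volume (by fun_prop) (by fun_prop)).1 hoddae
  have hc0 : c = 0 := by
    have := congrFun hoddall 0
    simp only [neg_zero, primitive_zero, zero_add] at this
    linarith
  subst hc0
  have hveq : v =ᵐ[volume] fun x => (primitive g x : ℂ) := by
    filter_upwards [hvw, him] with x h1 h2
    apply Complex.ext
    · simpa using h1
    · simpa using h2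
  refine ⟨g, hg, fun x => by simpa using congrFun hoddall x, hη.ae_eq ?_, hveq⟩
  filter_upwards [hveq] with x hx
  simp [eta, hx]

end WeakDerivative

/-! ### Existence of a minimizer -/

section Existence

/-- Bounded sequences in a separable Hilbert space have weakly convergent subsequences. -/
lemma exists_weakly_convergent_subseq {H : Type*} [NormedAddCommGroup H] [InnerProductSpace ℝ H]
    [CompleteSpace H] [TopologicalSpace.SeparableSpace H] {x : ℕ → H} {R : ℝ}
    (hx : ∀ n, ‖x n‖ ≤ R) :
    ∃ (y : H) (φ : ℕ → ℕ), StrictMono φ ∧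
      ∀ l : H →L[ℝ] ℝ, Tendsto (fun n => l (x (φ n))) atTop (𝓝 (l y)) := by
  -- Riesz representation transfers the sequence to the dual, where sequential Banach–Alaoglu
  -- applies.
  let f : ℕ → WeakDual ℝ H := fun n => StrongDual.toWeakDual (InnerProductSpace.toDual ℝ H (x n))
  obtain ⟨a, -, φ, hφ, ht⟩ := WeakDual.isSeqCompact_closedBall ℝ H 0 R (x := f) (fun n => by
    simpa [f] using hx n)
  refine ⟨(InnerProductSpace.toDual ℝ H).symm (WeakDual.toStrongDual a), φ, hφ, fun l => ?_⟩
  have h1 := ((WeakDual.eval_continuous ((InnerProductSpace.toDual ℝ H).symm l)).tendsto a).comp ht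
  have h2 (z : H) : l z = ⟪z, (InnerProductSpace.toDual ℝ H).symm l⟫ := by
    rw [real_inner_comm, InnerProductSpace.toDual_symm_apply]
  simp only [h2]
  rw [InnerProductSpace.toDual_symm_apply]
  exact h1

/-- `g` is the derivative of a real odd function of finite energy. -/
structure IsAdmissible (g : ℝ → ℝ) : Prop where
  memLp : MemLp g 2
  odd : ∀ x, primitive g (-x) = -primitive g x
  memLp_eta : MemLp (fun x => 1 - primitive g x ^ 2) 2

lemma primitive_neg_of_even {g : ℝ → ℝ} (hg : ∀ x, g (-x) = g x) (x : ℝ) :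
    primitive g (-x) = -primitive g x := by
  have h := intervalIntegral.integral_comp_neg (a := 0) (b := x) g
  simp only [hg, neg_zero] at h
  rw [primitive, primitive, h, intervalIntegral.integral_symm]

lemma exists_isAdmissible : ∃ g, IsAdmissible g := by
  -- The primitive is `x` truncated to `[-1, 1]`, so `1 - |v|²` has compact support.
  let g : ℝ → ℝ := (Set.Ioo (-1) 1).indicator fun _ => 1
  have hg : MemLp g 2 := memLp_indicator_const 2 measurableSet_Ioo 1 (.inr (by simp))
  have heven : ∀ x, g (-x) = g x := fun x => by
    have : -x ∈ Set.Ioo (-1 : ℝ) 1 ↔ x ∈ Set.Ioo (-1 : ℝ) 1 := by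
      simp only [Set.mem_Ioo]
      constructor <;> rintro ⟨h1, h2⟩ <;> constructor <;> linarith
    by_cases hx : x ∈ Set.Ioo (-1 : ℝ) 1
    · simp [g, Set.indicator_of_mem hx, Set.indicator_of_mem (this.2 hx)]
    · simp [g, Set.indicator_of_notMem hx, Set.indicator_of_notMem (mt this.1 hx)]
  have hodd := primitive_neg_of_even heven
  have hone : ∀ x, 1 ≤ x → primitive g x = 1 := fun x hx => by
    rw [primitive, intervalIntegral.integral_of_le (by linarith),
      setIntegral_indicator measurableSet_Ioo]
    have : Set.Ioc 0 x ∩ Set.Ioo (-1) 1 = Set.Ioo (0 : ℝ) 1 := by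
      ext t
      simp only [Set.mem_inter_iff, Set.mem_Ioc, Set.mem_Ioo]
      constructor
      · rintro ⟨⟨h1, h2⟩, h3, h4⟩
        exact ⟨h1, h4⟩
      · rintro ⟨h1, h2⟩
        exact ⟨⟨h1, by linarith⟩, by linarith, h2⟩
    rw [this]
    simp
  have hcont := continuous_primitive_of_memLp hg
  refine ⟨g, hg, hodd, Continuous.memLp_of_hasCompactSupport (by fun_prop) ?_⟩
  refine HasCompactSupport.intro (isCompact_Icc (a := (-1 : ℝ)) (b := 1)) fun x hx => ?_
  rcases lt_or_ge x (-1) with h | h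
  · have := hone (-x) (by linarith)
    rw [hodd] at this
    nlinarith
  · have hx1 : 1 < x := by
      by_contra h'
      exact hx ⟨h, not_lt.1 h'⟩
    rw [hone x hx1.le]
    norm_num

/-- Evaluating the primitive at `x` is, up to sign, an inner product with the indicator of the
interval from `0` to `x`. -/
lemma tendsto_primitive {g : ℕ → ℝ → ℝ} (hg : ∀ n, MemLp (g n) 2)
    {γ : ℝ → ℝ} (hγ : MemLp γ 2)
    (h : ∀ l : Lp ℝ 2 (volume : Measure ℝ) →L[ℝ] ℝ,
      Tendsto (fun n => l (hg n).toLp) atTop (𝓝 (l hγ.toLp))) (x : ℝ) :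
    Tendsto (fun n => primitive (g n) x) atTop (𝓝 (primitive γ x)) := by
  have hs : volume (Set.uIoc 0 x) ≠ ⊤ := by
    rw [Set.uIoc]; exact measure_Ioc_lt_top.ne
  have key {f : ℝ → ℝ} (hf : MemLp f 2) : primitive f x = (if 0 ≤ x then 1 else -1 : ℝ) *
      innerSL ℝ (indicatorConstLp 2 measurableSet_uIoc hs (1 : ℝ)) hf.toLp := by
    rw [innerSL_apply_apply, L2.inner_indicatorConstLp_one, primitive,
      intervalIntegral.intervalIntegral_eq_integral_uIoc, smul_eq_mul]
    congr 1
    exact setIntegral_congr_ae measurableSet_uIoc (hf.coeFn_toLp.mono fun t ht _ => ht.symm)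
  rw [key hγ]
  simp_rw [fun n => key (hg n)]
  exact (h _).const_mul _

variable {W : SignedMeasure ℝ}

/-- The energy attains its minimum over the odd real functions of finite energy. -/
theorem exists_isAdmissible_energy_le (hW : IsEven W) (hκ : FourierLowerBound W) :
    ∃ g, IsAdmissible g ∧ ∀ g', IsAdmissible g' →
      energy W (fun x => (primitive g x : ℂ)) ≤ energy W (fun x => (primitive g' x : ℂ)) := by
  have : Fact ((2 : ENNReal) ≠ ⊤) := ⟨by simp⟩
  let J : (ℝ → ℝ) → ℝ := fun g => energy W (fun x => (primitive g x : ℂ))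
  let S : Set ℝ := J '' {g | IsAdmissible g}
  have hJ {g : ℝ → ℝ} (hg : IsAdmissible g) : J g = 1 / 2 * ‖hg.memLp.toLp‖ ^ 2 +
      1 / 4 * pairing W hg.memLp_eta.toLp hg.memLp_eta.toLp :=
    energy_eq W hg.memLp hg.memLp_eta .rfl
  have hne : S.Nonempty := exists_isAdmissible.elim fun g hg => ⟨_, g, hg, rfl⟩
  have hbdd : BddBelow S := by
    refine ⟨0, ?_⟩
    rintro _ ⟨g, hg, rfl⟩
    rw [hJ hg]
    have := pairing_self_nonneg hκ hg.memLp_eta.toLp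
    positivity
  obtain ⟨e, -, he, heS⟩ := exists_seq_tendsto_sInf hne hbdd
  choose g hg hge using heS
  obtain ⟨e', he'⟩ := he.bddAbove_range
  obtain ⟨R, hR⟩ := exists_norm_le_of_energy_le hκ e'
  have hbound (n : ℕ) := hR (hg n).memLp (hg n).memLp_eta (by
    rw [← hJ (hg n), hge]; exact he' ⟨n, rfl⟩)
  obtain ⟨γ, φ₁, hφ₁, hγ⟩ := exists_weakly_convergent_subseq fun n => (hbound n).1
  obtain ⟨θ, φ₂, hφ₂, hθ⟩ := exists_weakly_convergent_subseq fun n => (hbound (φ₁ n)).2.1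
  let φ : ℕ → ℕ := φ₁ ∘ φ₂
  have hφ : StrictMono φ := hφ₁.comp hφ₂
  have hγφ (l : Lp ℝ 2 (volume : Measure ℝ) →L[ℝ] ℝ) :
      Tendsto (fun n => l (hg (φ n)).memLp.toLp) atTop (𝓝 (l γ)) :=
    (hγ l).comp hφ₂.tendsto_atTop
  have hγL : MemLp γ 2 := Lp.memLp γ
  have hγe : hγL.toLp = γ := Lp.toLp_coeFn γ hγL
  have hlim (x : ℝ) : Tendsto (fun n => primitive (g (φ n)) x) atTop (𝓝 (primitive γ x)) :=
    tendsto_primitive (fun n => (hg (φ n)).memLp) hγL (by rw [hγe]; exact hγφ) x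
  have hcont := continuous_primitive_of_memLp hγL
  -- The weak limit of `η` is tested against bump functions; pointwise convergence and the uniform
  -- bound `R` allow dominated convergence.
  have hθη : θ =ᵐ[volume] fun x => 1 - primitive γ x ^ 2 := by
    refine ae_eq_of_integral_contDiff_smul_eq ((Lp.memLp θ).locallyIntegrable (by norm_num))
      (by fun_prop : Continuous fun x => 1 - primitive γ x ^ 2).locallyIntegrable
      fun ψ hψ hc => ?_
    have hψL : MemLp ψ 2 := hψ.continuous.memLp_of_hasCompactSupport hc
    have h1 := hθ (innerSL ℝ hψL.toLp)
    simp only [innerSL_apply_apply] at h1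
    rw [← Lp.toLp_coeFn θ (Lp.memLp θ), inner_toLp_real] at h1
    simp_rw [inner_toLp_real] at h1
    refine tendsto_nhds_unique h1 ?_
    refine tendsto_integral_of_dominated_convergence (fun x => |ψ x| * (1 + R ^ 2))
      (fun n => ?_) ?_ (fun n => .of_forall fun x => ?_) (.of_forall fun x => ?_)
    · have := continuous_primitive_of_memLp (hg (φ n)).memLp
      exact (hψ.continuous.mul (continuous_const.sub (this.pow 2))).aestronglyMeasurable
    · exact (hψ.continuous.integrable_of_hasCompactSupport hc).abs.mul_const _
    · have h2 := (hbound (φ n)).2.2 x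
      rw [norm_mul, Real.norm_eq_abs, Real.norm_eq_abs]
      refine mul_le_mul_of_nonneg_left ?_ (abs_nonneg _)
      have h3 : primitive (g (φ n)) x ^ 2 ≤ R ^ 2 := by
        rw [← sq_abs]; gcongr
      change |1 - primitive (g (φ n)) x ^ 2| ≤ 1 + R ^ 2
      rw [abs_le]
      constructor <;> nlinarith [sq_nonneg (primitive (g (φ n)) x)]
    · exact tendsto_const_nhds.mul (tendsto_const_nhds.sub ((hlim x).pow 2))
  have hadm : IsAdmissible γ := by
    refine ⟨hγL, fun x => ?_, (Lp.memLp θ).ae_eq hθη⟩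
    refine tendsto_nhds_unique (hlim (-x)) ?_
    simp_rw [fun n => (hg (φ n)).odd x]
    exact (hlim x).neg
  have hηe : hadm.memLp_eta.toLp = θ := by
    rw [← Lp.toLp_coeFn θ (Lp.memLp θ)]
    exact (MemLp.toLp_eq_toLp_iff _ _).2 hθη.symm
  refine ⟨γ, hadm, fun g' hg' => ?_⟩
  have hmin : J γ ≤ sInf S := by
    -- Weak lower semicontinuity: by convexity the energy lies above its tangent at `(γ, θ)`, and
    -- this affine minorant passes to the weak limit.
    have hlow : Tendsto (fun n =>
        1 / 2 * (2 * ⟪γ, (hg (φ n)).memLp.toLp⟫ - ‖γ‖ ^ 2) +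
        1 / 4 * (2 * pairing W θ (hg (φ n)).memLp_eta.toLp - pairing W θ θ)) atTop
        (𝓝 (1 / 2 * (2 * ⟪γ, γ⟫ - ‖γ‖ ^ 2) + 1 / 4 * (2 * pairing W θ θ - pairing W θ θ))) :=
      ((((hγφ (innerSL ℝ γ)).const_mul 2).sub_const _).const_mul _).add
        ((((hθ (pairing W θ)).const_mul 2).sub_const _).const_mul _)
    have hJγ : J γ =
        1 / 2 * (2 * ⟪γ, γ⟫ - ‖γ‖ ^ 2) + 1 / 4 * (2 * pairing W θ θ - pairing W θ θ) := by
      rw [hJ hadm, hηe, hγe, real_inner_self_eq_norm_sq]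
      ring
    rw [hJγ]
    refine le_of_tendsto_of_tendsto' hlow (he.comp hφ.tendsto_atTop) fun n => ?_
    rw [Function.comp_apply, ← hge, hJ (hg (φ n))]
    generalize (hg (φ n)).memLp.toLp = a
    generalize (hg (φ n)).memLp_eta.toLp = b
    have h1 : 0 ≤ ‖a‖ ^ 2 - 2 * ⟪γ, a⟫ + ‖γ‖ ^ 2 := by
      rw [real_inner_comm, ← norm_sub_sq_real]
      positivity
    have h2 := pairing_self_nonneg hκ (b - θ)
    simp only [map_sub, sub_apply] at h2
    rw [hW.pairing_symm b θ] at h2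
    linarith
  exact hmin.trans (csInf_le hbdd ⟨g', hg', rfl⟩)

end Existence

/-! ### The Euler–Lagrange equation -/

section EulerLagrange

lemma eq_zero_of_forall_quartic_nonneg {L a b c : ℝ}
    (h : ∀ t : ℝ, 0 ≤ t * L + t ^ 2 * a + t ^ 3 * b + t ^ 4 * c) : L = 0 := by
  have hd : HasDerivAt (fun t : ℝ => t * L + t ^ 2 * a + t ^ 3 * b + t ^ 4 * c) L 0 := by
    have := ((((hasDerivAt_id (0 : ℝ)).mul_const L).add
      ((hasDerivAt_pow 2 (0 : ℝ)).mul_const a)).add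
      ((hasDerivAt_pow 3 (0 : ℝ)).mul_const b)).add ((hasDerivAt_pow 4 (0 : ℝ)).mul_const c)
    exact HasDerivAt.congr_deriv this (by simp)
  refine IsLocalMin.hasDerivAt_eq_zero (.of_forall fun t => ?_) hd
  simpa using h t

variable {g : ℝ → ℝ}

lemma IsAdmissible.ae_even (hg : IsAdmissible g) : ∀ᵐ x, g (-x) = g x := by
  have h1 := _root_.LocallyIntegrable.ae_hasDerivAt_integral (locallyIntegrable_of_memLp hg.memLp)
  have h2 := (Measure.measurePreserving_neg (volume : Measure ℝ)).quasiMeasurePreserving.ae h1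
  filter_upwards [h1, h2] with x hx hx'
  have d1 : HasDerivAt (fun y => -primitive g y) (-g x) x := (hx 0).neg
  have d2 : HasDerivAt (fun y => primitive g (-y)) (g (-x) * -1) x :=
    HasDerivAt.comp x (h₂ := primitive g) (hx' 0) (hasDerivAt_neg x)
  simp only [hg.odd] at d2
  linarith [d1.unique d2]

lemma primitive_deriv {ψ : ℝ → ℝ} (hψ : ContDiff ℝ 1 ψ) (x : ℝ) :
    primitive (deriv ψ) x = ψ x - ψ 0 :=
  intervalIntegral.integral_deriv_eq_sub (fun t _ => hψ.differentiable one_ne_zero t)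
    ((hψ.continuous_deriv le_rfl).intervalIntegrable _ _)

lemma memLp_deriv {ψ : ℝ → ℝ} (hψ : ContDiff ℝ 1 ψ) (hc : HasCompactSupport ψ) :
    MemLp (deriv ψ) 2 :=
  (hψ.continuous_deriv le_rfl).memLp_of_hasCompactSupport hc.deriv

lemma IsAdmissible.memLp_primitive_mul (hg : IsAdmissible g) {ψ : ℝ → ℝ} (hψ : Continuous ψ)
    (hc : HasCompactSupport ψ) : MemLp (fun x => primitive g x * ψ x) 2 :=
  ((continuous_primitive_of_memLp hg.memLp).mul hψ).memLp_of_hasCompactSupport hc.mul_left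

variable {W : SignedMeasure ℝ}

/-- Oddness of `ψ` keeps `g + tψ'` admissible. The energy along this line is a quartic polynomial in
`t`, minimal at `0`, so its linear coefficient vanishes. -/
lemma integral_deriv_mul_eq_of_odd (hW : IsEven W) (hg : IsAdmissible g)
    (hmin : ∀ g', IsAdmissible g' →
      energy W (fun x => (primitive g x : ℂ)) ≤ energy W (fun x => (primitive g' x : ℂ)))
    {ψ : ℝ → ℝ} (hψ : ContDiff ℝ 1 ψ) (hc : HasCompactSupport ψ) (hodd : ∀ x, ψ (-x) = -ψ x) :
    ∫ x, deriv ψ x * g x =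
      pairing W hg.memLp_eta.toLp (hg.memLp_primitive_mul hψ.continuous hc).toLp := by
  have hψ0 : ψ 0 = 0 := by
    have := hodd 0
    rw [neg_zero] at this
    linarith
  have hd := memLp_deriv hψ hc
  have hwψ := hg.memLp_primitive_mul hψ.continuous hc
  have hψψ : MemLp (fun x => ψ x * ψ x) 2 :=
    (hψ.continuous.mul hψ.continuous).memLp_of_hasCompactSupport hc.mul_left
  let p (t : ℝ) : ℝ → ℝ := fun x => g x + t * deriv ψ x
  have hpL (t : ℝ) : MemLp (p t) 2 := hg.memLp.add (hd.const_mul t)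
  have hprim (t x : ℝ) : primitive (p t) x = primitive g x + t * ψ x := by
    have h1 := primitive_deriv hψ x
    rw [hψ0, sub_zero] at h1
    rw [← h1, primitive, primitive, primitive, ← intervalIntegral.integral_const_mul]
    exact intervalIntegral.integral_add (intervalIntegrable_of_memLp hg.memLp _ _)
      (intervalIntegrable_of_memLp (hd.const_mul t) _ _)
  have heta (t : ℝ) : (fun x => 1 - primitive (p t) x ^ 2) =
      ((fun x => 1 - primitive g x ^ 2) + (-2 * t) • fun x => primitive g x * ψ x) +
        (-t ^ 2) • fun x => ψ x * ψ x := by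
    ext x
    simp only [hprim, Pi.add_apply, Pi.smul_apply, smul_eq_mul]
    ring
  have hηL (t : ℝ) : MemLp (fun x => 1 - primitive (p t) x ^ 2) 2 := by
    rw [heta]
    exact (hg.memLp_eta.add (hwψ.const_smul _)).add (hψψ.const_smul _)
  have hadm (t : ℝ) : IsAdmissible (p t) := by
    refine ⟨hpL t, fun x => ?_, hηL t⟩
    rw [hprim, hprim, hg.odd, hodd]
    ring
  have hpe (t : ℝ) : (hpL t).toLp = hg.memLp.toLp + t • hd.toLp := rfl
  have hηe (t : ℝ) : (hηL t).toLp =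
      hg.memLp_eta.toLp + (-2 * t) • hwψ.toLp + (-t ^ 2) • hψψ.toLp := by
    have : (hηL t).toLp =
        ((hg.memLp_eta.add (hwψ.const_smul (-2 * t))).add (hψψ.const_smul (-t ^ 2))).toLp :=
      (MemLp.toLp_eq_toLp_iff _ _).2 (.of_forall fun x => congrFun (heta t) x)
    rw [this]
    rfl
  have hgd : ∫ x, deriv ψ x * g x = ⟪hg.memLp.toLp, hd.toLp⟫ := by
    rw [real_inner_comm, inner_toLp_real]
  rw [hgd]
  have key (t : ℝ) := hmin (p t) (hadm t)
  simp_rw [fun t => energy_eq W (hpL t) (hηL t) .rfl, energy_eq W hg.memLp hg.memLp_eta .rfl,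
    hpe, hηe] at key
  generalize hg.memLp.toLp = a at key ⊢
  generalize hd.toLp = b at key ⊢
  generalize hg.memLp_eta.toLp = η at key ⊢
  generalize hwψ.toLp = α at key ⊢
  generalize hψψ.toLp = β at key ⊢
  have hzero : ⟪a, b⟫ - pairing W η α = 0 := by
    refine eq_zero_of_forall_quartic_nonneg (a := 1 / 2 * ‖b‖ ^ 2 + pairing W α α -
      1 / 2 * pairing W η β) (b := pairing W α β) (c := 1 / 4 * pairing W β β) fun t => ?_
    have h1 := key t
    rw [norm_add_sq_real, norm_smul, mul_pow, Real.norm_eq_abs, sq_abs,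
      real_inner_smul_right] at h1
    simp only [map_add, map_smul, add_apply, smul_apply, smul_eq_mul] at h1
    rw [hW.pairing_symm α η, hW.pairing_symm β η, hW.pairing_symm β α] at h1
    linarith
  linarith

/-- Reflecting `φ` changes the sign of both sides, so the identity for the odd function `φ - φ(-·)`
is twice the one wanted. -/
lemma integral_deriv_mul_eq (hW : IsEven W) (hg : IsAdmissible g)
    (hmin : ∀ g', IsAdmissible g' →
      energy W (fun x => (primitive g x : ℂ)) ≤ energy W (fun x => (primitive g' x : ℂ)))
    {φ : ℝ → ℝ} (hφ : ContDiff ℝ 1 φ) (hc : HasCompactSupport φ) :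
    ∫ x, deriv φ x * g x =
      ∫ x, conv W (fun x => 1 - primitive g x ^ 2) x * (primitive g x * φ x) := by
  let φr : ℝ → ℝ := fun x => φ (-x)
  have hr : ContDiff ℝ 1 φr := hφ.comp contDiff_neg
  have hrc : HasCompactSupport φr := hc.comp_homeomorph (Homeomorph.neg ℝ)
  have hdr (x : ℝ) : deriv φr x = -deriv φ (-x) := deriv_comp_neg φ x
  have hd := memLp_deriv hφ hc
  have hrd := memLp_deriv hr hrc
  have hwφ := hg.memLp_primitive_mul hφ.continuous hc
  have hwr := hg.memLp_primitive_mul hr.continuous hrc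
  have hodd := integral_deriv_mul_eq_of_odd hW hg hmin (ψ := fun x => φ x - φr x) (hφ.sub hr)
    (hc.sub hrc) (fun x => by simp [φr])
  have hL : ∫ x, deriv φr x * g x = -∫ x, deriv φ x * g x := by
    rw [← integral_neg_eq_self (fun x => deriv φr x * g x), ← integral_neg]
    refine integral_congr_ae ?_
    filter_upwards [hg.ae_even] with x hx
    rw [hdr, hx, neg_neg, neg_mul]
  have hR : ∫ x, conv W (fun x => 1 - primitive g x ^ 2) x * (primitive g x * φr x) =
      -∫ x, conv W (fun x => 1 - primitive g x ^ 2) x * (primitive g x * φ x) := by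
    rw [← integral_neg_eq_self, ← integral_neg]
    congr 1 with x
    rw [hW.conv_neg (fun x => by rw [hg.odd, neg_sq]), hg.odd]
    simp [φr]
  have hdiff (x : ℝ) : deriv (fun x => φ x - φr x) x = deriv φ x - deriv φr x :=
    deriv_fun_sub (hφ.differentiable one_ne_zero x) (hr.differentiable one_ne_zero x)
  simp only [hdiff, sub_mul] at hodd
  have hi : Integrable fun x => deriv φ x * g x := hd.integrable_mul hg.memLp
  have hri : Integrable fun x => deriv φr x * g x := hrd.integrable_mul hg.memLp
  rw [integral_sub hi hri, hL] at hodd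
  have hsub : (hg.memLp_primitive_mul (hφ.sub hr).continuous (hc.sub hrc)).toLp =
      hwφ.toLp - hwr.toLp := by
    rw [← MemLp.toLp_sub]
    exact (MemLp.toLp_eq_toLp_iff _ _).2 (.of_forall fun x => mul_sub _ _ _)
  rw [hsub, map_sub, ← integral_conv_mul, ← integral_conv_mul, hR] at hodd
  linarith

end EulerLagrange

end NonlocalGP

end

theorem theorem1p4 (W : MeasureTheory.SignedMeasure ℝ)
    (hW : NonlocalGP.IsNormalizedEven W) (hκ : NonlocalGP.FourierLowerBound W) :
    ∃ u : ℝ → ℂ, u ∈ NonlocalGP.oddEnergySpace ∧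
      NonlocalGP.IsBlackSoliton W u ∧
      IsMinOn (NonlocalGP.energy W) NonlocalGP.oddEnergySpace u := by
  open NonlocalGP in
  obtain ⟨g, hg, hmin⟩ := exists_isAdmissible_energy_le hW.1 hκ
  have hmem := primitive_mem_oddEnergySpace hg.memLp hg.odd hg.memLp_eta
  have hcont := continuous_primitive_of_memLp hg.memLp
  refine ⟨fun x => (primitive g x : ℂ), hmem, ⟨hmem.1, by fun_prop, ⟨hmem.1.1, ?_⟩,
    0, by simp [primitive_zero]⟩, fun v hv => ?_⟩
  · intro φ hφ hc
    have h1 : ∫ x, deriv φ x • weakDeriv (fun x => (primitive g x : ℂ)) x =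
        ∫ x, ((deriv φ x * g x : ℝ) : ℂ) := by
      refine integral_congr_ae ?_
      filter_upwards [(hasWeakDeriv_primitive hg.memLp).weakDeriv_ae_eq] with x hx
      rw [hx, Complex.real_smul, Complex.ofReal_mul]
    rw [h1, eta_ofReal]
    simp only [Complex.real_smul, ← Complex.ofReal_mul]
    rw [integral_complex_ofReal, integral_complex_ofReal,
      integral_deriv_mul_eq hW.1 hg hmin hφ hc]
    congr 2 with x
    ring
  -- The energy depends only on the class modulo null sets, so each competitor may be replaced by
  -- its primitive.
  · obtain ⟨k, hk, hodd, hη, hv'⟩ := exists_primitive_of_mem_oddEnergySpace hv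
    have h := hmin k ⟨hk, hodd, hη⟩
    rwa [energy_eq W hk hη .rfl, ← energy_eq W hk hη hv'] at h
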